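/- Let $p$ be a prime. For a commutative ring $A$ let $A[[t^{\mathbb Q}]]$ be the ring of generalized power series $\sum_{i\in\mathbb Q,\, i\ge 0} c_i t^i$ with $c_i\in A$ and $\{i : c_i\ne 0\}$ well-ordered. Let $R$ be either $\mathbb Z_p[[t^{\mathbb Q}]]/(t-p)$ or $W(\overline{\mathbb F}_p)[[t^{\mathbb Q}]]/(t-p)$ (the latter is Poonen's spherical completion of $\mathcal O_{\mathbb C_p}$). Notation: $W(R)$ is the ring of $p$-typical Witt vectors, $W_{p^n}(R)$ its truncation to the $n+1$ components indexed by $1,p,\dots,p^n$, $F$ the Frobenius ($W(R)\to W(R)$ and $W_{p^n}(R)\to W_{p^{n-1}}(R)$), $V$ the Verschiebung, $[r]=(r,0,0,\dots)$. Put $I_0=R$, $I_i=\{r\in R : r^p\in pI_{i-1}\}$ for $i\ge1$ (these are ideals), $I_\infty=\bigcap_i I_i$, and $B(r,I)=r+I$. Then $F:W(R)\to W(R)$ is surjective. Moreover $R$ satisfies all of the following: 1. $F:W_{p^n}(R)\to W_{p^{n-1}}(R)$ is surjective for all $n\ge2$; in particular for $n=2$. 2. For every $x\in W(R)$ there is $r\in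 R$ with $x-[r]\in pW(R)$. 3. The image of $F:W(R)\to W(R)$ contains $[r]$ for all $r\in R$. 4. For all $n\ge 2$ the image of $F:W_{p^n}(R)\to W_{p^{n-1}}(R)$ contains all $(r,0,\dots,0)$, $r\in R$; in particular for $n=2$. 5. The image of $F:W(R)\to W(R)$ contains $V(1)$. 6. For all $n\ge2$ the image of $F:W_{p^n}(R)\to W_{p^{n-1}}(R)$ contains $V(1)$. 7. For all $n\ge2$ the image of $F:W_{p^n}(R)\to W_{p^{n-1}}(R)$ contains $V^{n-1}(1)$. 8. The image of $F:W_{p^2}(R)\to W_p(R)$ contains $V(1)$. 9. $F^n:W_{p^n}(R)\to W_1(R)$ is surjective for all $n\ge1$; in particular for $n=1$. 10. If $r_0,r_1,\dots\in R$ satisfy $B(r_0,I_0)\supseteq B(r_1,I_1)\supseteq\cdots$, then $\bigcap_{i\ge0}B(r_i,I_i)\neq\emptyset$. 11. The $p$-th power map on $R/pI_\infty$ is surjective. 12. For each $n\ge1$ the $p$-th power map on $R/pI_n$ is surjective; in particular for $n=1$. 13. For every $r\in R$ there is $s\in R$ with $s^p\equiv pr \pmod{p^2R}$. 14. There are $r,s\in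 R$ with $r^p\equiv -p\pmod{psR}$ and $s\in I_1$. 15. There are $r,s\in R$ with $r^p\equiv -p\pmod{psR}$ and $s^N\in pR$ for some integer $N>0$. 16. The Frobenius $\bar r\mapsto\bar r^p$ on $R/pR$ is surjective. Finally, $p$ is not invertible in $R$. -/

import Mathlib

/-! ### Finite-length Witt vectors and their Frobenius

The ring `W_{p^n}(R)`, with components indexed by `1, p, …, p^n`, is
`TruncatedWittVector p (n + 1) R`; the ring `W(R)` is `WittVector p R`. -/

namespace WittFrobenius

section Truncated

variable (p : ℕ) [hp : Fact p.Prime]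

theorem ker_truncate_le {R : Type*} [CommRing R] (n : ℕ) :
    RingHom.ker (WittVector.truncate (p := p) (R := R) (n + 1)) ≤
      RingHom.ker ((WittVector.truncate (p := p) (R := R) n).comp WittVector.frobenius) := by
  intro x hx
  rw [WittVector.mem_ker_truncate] at hx
  obtain ⟨y, rfl⟩ : ∃ y : WittVector p R, x = WittVector.verschiebung^[n + 1] y :=
    ⟨_, WittVector.eq_iterate_verschiebung hx⟩
  rw [RingHom.mem_ker, RingHom.comp_apply, Function.iterate_succ_apply',
    WittVector.frobenius_verschiebung, map_mul]
  have h : WittVector.verschiebung^[n] y ∈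
      RingHom.ker (WittVector.truncate (p := p) (R := R) n) := by
    rw [WittVector.mem_ker_truncate]
    intro i hi
    exact WittVector.iterate_verschiebung_coeff_eq_zero y hi
  rw [RingHom.mem_ker] at h
  rw [h, zero_mul]

/-- The Frobenius `F : W_{p^n}(R) → W_{p^{n-1}}(R)`: the ring homomorphism induced by the Frobenius
of `W(R)` on the truncations. -/
noncomputable def truncFrobenius (R : Type*) [CommRing R] (n : ℕ) :
    TruncatedWittVector p (n + 1) R →+* TruncatedWittVector p n R :=
  RingHom.liftOfSurjective (WittVector.truncate (p := p) (R := R) (n + 1))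
    (WittVector.truncate_surjective (p := p) (n + 1) R)
    ⟨(WittVector.truncate (p := p) (R := R) n).comp WittVector.frobenius, ker_truncate_le p n⟩

theorem truncFrobenius_truncate {R : Type*} [CommRing R] (n : ℕ) (x : WittVector p R) :
    truncFrobenius p R n (WittVector.truncate (n + 1) x) =
      WittVector.truncate n (WittVector.frobenius x) :=
  RingHom.liftOfRightInverse_comp_apply _ _ _ _ x

/-- The iterate `F^n : W_{p^n}(R) → W_1(R)`. -/
noncomputable def truncFrobeniusIter (R : Type*) [CommRing R] :
    (n : ℕ) → TruncatedWittVector p (n + 1) R →+* TruncatedWittVector p 1 R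
  | 0 => RingHom.id _
  | n + 1 => (truncFrobeniusIter R n).comp (truncFrobenius p R (n + 1))

end Truncated

/-! ### The ideals `I_i` and the balls -/

section Ideals

variable (p : ℕ) (R : Type*) [CommRing R]

/-- `I_0 = R` and `I_{i+1} = {r | r^p ∈ p I_i}`, as sets. -/
def frobSet : ℕ → Set R
  | 0 => Set.univ
  | i + 1 => {r | ∃ s ∈ frobSet i, r ^ p = (p : R) * s}

theorem frobSet_succ_subset (i : ℕ) : frobSet p R (i + 1) ⊆ frobSet p R i := by
  induction i with
  | zero => exact fun _ _ => trivial
  | succ i ih =>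
    rintro r ⟨s, hs, h⟩
    exact ⟨s, ih hs, h⟩

theorem frobSet_smul (i : ℕ) (c r : R) (h : r ∈ frobSet p R i) : c * r ∈ frobSet p R i := by
  induction i generalizing c r with
  | zero => trivial
  | succ i ih =>
    obtain ⟨s, hs, h⟩ := h
    exact ⟨c ^ p * s, ih _ _ hs, by rw [mul_pow, h]; ring⟩

variable [hp : Fact p.Prime]

theorem frobSet_add (i : ℕ) (x y : R) (hx : x ∈ frobSet p R i) (hy : y ∈ frobSet p R i) :
    x + y ∈ frobSet p R i := by
  induction i generalizing x y with
  | zero => trivial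
  | succ i ih =>
    have hx' := frobSet_succ_subset p R i hx
    obtain ⟨s, hs, h⟩ := hx
    obtain ⟨t, ht, h'⟩ := hy
    obtain ⟨r, hr⟩ := exists_add_pow_prime_eq hp.out x y
    refine ⟨s + t + (y * r) * x, ih _ _ (ih _ _ hs ht) (frobSet_smul p R i _ _ hx'), ?_⟩
    rw [hr, h, h']
    ring

theorem frobSet_zero_mem (i : ℕ) : (0 : R) ∈ frobSet p R i := by
  induction i with
  | zero => trivial
  | succ i ih => exact ⟨0, ih, by simp [hp.out.ne_zero]⟩

/-- The ideal `I_i` of `R`. -/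
def frobIdeal (i : ℕ) : Ideal R where
  carrier := frobSet p R i
  add_mem' := fun {x y} hx hy => frobSet_add p R i x y hx hy
  zero_mem' := frobSet_zero_mem p R i
  smul_mem' := fun c r h => frobSet_smul p R i c r h

/-- The ideal `I_∞`, the intersection of all the `I_i`. -/
def frobIdealInf : Ideal R := ⨅ i, frobIdeal p R i

/-- The ball `B(r, I) = r + I`. -/
def ball {R : Type*} [CommRing R] (r : R) (I : Ideal R) : Set R := {x | x - r ∈ I}

end Ideals

/-! ### The conditions on a ring `R` -/

section Conditions

variable (p : ℕ) [hp : Fact p.Prime] (R : Type*) [CommRing R]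

/-- `F : W(R) → W(R)` is surjective. -/
def FrobSurj : Prop :=
  Function.Surjective (WittVector.frobenius : WittVector p R →+* WittVector p R)

/-- `F : W_{p^n}(R) → W_{p^{n-1}}(R)` is surjective for all `n ≥ 2`. -/
def FrobSurjFinite : Prop :=
  ∀ n : ℕ, 2 ≤ n → Function.Surjective (truncFrobenius p R n)

/-- `F : W_{p^2}(R) → W_p(R)` is surjective. -/
def FrobSurjFiniteTwo : Prop :=
  Function.Surjective (truncFrobenius p R 2)

/-- Every element of `W(R)` is congruent to a Teichmüller element modulo `p W(R)`. -/
def TeichDense : Prop :=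
  ∀ x : WittVector p R, ∃ r : R, ∃ y : WittVector p R,
    x - WittVector.teichmuller p r = (p : WittVector p R) * y

/-- The image of `F : W(R) → W(R)` contains all Teichmüller elements. -/
def TeichInImage : Prop :=
  ∀ r : R, ∃ x : WittVector p R, WittVector.frobenius x = WittVector.teichmuller p r

/-- The image of `F : W_{p^n}(R) → W_{p^{n-1}}(R)` contains all `(r, 0, …, 0)`, for all `n ≥ 2`. -/
def TeichInImageFinite : Prop :=
  ∀ n : ℕ, 2 ≤ n → ∀ r : R, ∃ x : TruncatedWittVector p (n + 1) R,
    truncFrobenius p R n x = WittVector.truncate n (WittVector.teichmuller p r)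

/-- The image of `F : W_{p^2}(R) → W_p(R)` contains all `(r, 0)`. -/
def TeichInImageFiniteTwo : Prop :=
  ∀ r : R, ∃ x : TruncatedWittVector p 3 R,
    truncFrobenius p R 2 x = WittVector.truncate 2 (WittVector.teichmuller p r)

/-- The image of `F : W(R) → W(R)` contains `V(1)`. -/
def VOneInImage : Prop :=
  ∃ x : WittVector p R, WittVector.frobenius x = WittVector.verschiebung 1

/-- For all `n ≥ 2`, the image of `F : W_{p^n}(R) → W_{p^{n-1}}(R)` contains `V(1)`. -/
def VOneInImageFinite : Prop :=
  ∀ n : ℕ, 2 ≤ n → ∃ x : TruncatedWittVector p (n + 1) R,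
    truncFrobenius p R n x = WittVector.truncate n (WittVector.verschiebung 1)

/-- For all `n ≥ 2`, the image of `F : W_{p^n}(R) → W_{p^{n-1}}(R)` contains `V^{n-1}(1)`. -/
def VPowOneInImageFinite : Prop :=
  ∀ n : ℕ, 2 ≤ n → ∃ x : TruncatedWittVector p (n + 1) R,
    truncFrobenius p R n x = WittVector.truncate n (WittVector.verschiebung^[n - 1] 1)

/-- The image of `F : W_{p^2}(R) → W_p(R)` contains `V(1)`. -/
def VOneInImageFiniteTwo : Prop :=
  ∃ x : TruncatedWittVector p 3 R,
    truncFrobenius p R 2 x = WittVector.truncate 2 (WittVector.verschiebung 1)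

/-- `F^n : W_{p^n}(R) → W_1(R)` is surjective for all `n ≥ 1`. -/
def FrobIterSurj : Prop :=
  ∀ n : ℕ, 1 ≤ n → Function.Surjective (truncFrobeniusIter p R n)

/-- `F : W_p(R) → W_1(R)` is surjective. -/
def FrobIterSurjOne : Prop :=
  Function.Surjective (truncFrobenius p R 1)

/-- `R` contains `p⁻¹`. -/
def PInvertible : Prop := IsUnit (p : R)

/-- Every decreasing sequence of balls `B(r_0, I_0) ⊇ B(r_1, I_1) ⊇ ⋯` has nonempty
intersection. -/
def BallsIntersect : Prop :=
  ∀ r : ℕ → R,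
    (∀ i, ball (r (i + 1)) (frobIdeal p R (i + 1)) ⊆ ball (r i) (frobIdeal p R i)) →
    (⋂ i, ball (r i) (frobIdeal p R i)).Nonempty

/-- The `p`-th power map on `R / p I_∞` is surjective. -/
def PthRootsInf : Prop :=
  Function.Surjective (fun x : R ⧸ (Ideal.span {(p : R)} * frobIdealInf p R) => x ^ p)

/-- For all `n ≥ 1`, the `p`-th power map on `R / p I_n` is surjective. -/
def PthRootsFinite : Prop :=
  ∀ n : ℕ, 1 ≤ n →
    Function.Surjective (fun x : R ⧸ (Ideal.span {(p : R)} * frobIdeal p R n) => x ^ p)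

/-- The `p`-th power map on `R / p I_1` is surjective. -/
def PthRootsFiniteOne : Prop :=
  Function.Surjective (fun x : R ⧸ (Ideal.span {(p : R)} * frobIdeal p R 1) => x ^ p)

/-- For every `r` there is `s` with `s^p ≡ p r` modulo `p^2 R`. -/
def PthRootsPMul : Prop :=
  ∀ r : R, ∃ s : R, (p : R) ^ 2 ∣ s ^ p - (p : R) * r

/-- There are `r, s` with `r^p ≡ -p` modulo `p s R` and `s ∈ I_1`. -/
def PthRootNegP : Prop :=
  ∃ r s : R, (p : R) * s ∣ r ^ p - (-(p : R)) ∧ s ∈ frobIdeal p R 1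

/-- There are `r, s` with `r^p ≡ -p` modulo `p s R` and `s^N ∈ p R` for some `N > 0`. -/
def PthRootNegPWeak : Prop :=
  ∃ r s : R, (p : R) * s ∣ r ^ p - (-(p : R)) ∧ ∃ N : ℕ, 0 < N ∧ (p : R) ∣ s ^ N

/-- The `p`-th power Frobenius on `R / p R` is surjective. -/
def PthRootsModP : Prop :=
  Function.Surjective (fun x : R ⧸ Ideal.span {(p : R)} => x ^ p)

/-- All of the conditions above, except for surjectivity of `F` on `W(R)` and invertibility
of `p`. -/
structure OtherConditions : Prop where
  frobSurjFinite : FrobSurjFinite p R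
  frobSurjFiniteTwo : FrobSurjFiniteTwo p R
  teichDense : TeichDense p R
  teichInImage : TeichInImage p R
  teichInImageFinite : TeichInImageFinite p R
  teichInImageFiniteTwo : TeichInImageFiniteTwo p R
  vOneInImage : VOneInImage p R
  vOneInImageFinite : VOneInImageFinite p R
  vPowOneInImageFinite : VPowOneInImageFinite p R
  vOneInImageFiniteTwo : VOneInImageFiniteTwo p R
  frobIterSurj : FrobIterSurj p R
  frobIterSurjOne : FrobIterSurjOne p R
  ballsIntersect : BallsIntersect p R
  pthRootsInf : PthRootsInf p R
  pthRootsFinite : PthRootsFinite p R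
  pthRootsFiniteOne : PthRootsFiniteOne p R
  pthRootsPMul : PthRootsPMul p R
  pthRootNegP : PthRootNegP p R
  pthRootNegPWeak : PthRootNegPWeak p R
  pthRootsModP : PthRootsModP p R

end Conditions

/-! ### Poonen's ring -/

/-- The ring `A⟦t^ℚ⟧` of generalized power series: formal sums `∑ c_i t^i` over rational `i ≥ 0`
with well-ordered support. -/
abbrev GenPowerSeries (A : Type*) [CommRing A] : Type _ := HahnSeries ℚ≥0 A

/-- The ring `A⟦t^ℚ⟧ / (t - p)`. -/
abbrev PoonenRing (p : ℕ) (A : Type*) [CommRing A] : Type _ :=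
  GenPowerSeries A ⧸
    Ideal.span {(HahnSeries.single (1 : ℚ≥0) (1 : A) - (p : GenPowerSeries A))}

end WittFrobenius

/-! Let `B` be the power series ring, `π : B → R` the projection, and `φ` the Frobenius lift on `B`
that sends `t` to `t^p` and acts on coefficients by a bijective Frobenius lift `σ`. By Dwork's lemma
each `b` in `B` gives a Witt vector over `R` with ghost components `π(φ^n b)`, and `F` replaces `b`
by `φ(b)`. As `R` has no `p`-torsion, ghost components determine Witt vectors.

For `y` in `W(R)`, approximations `b_n` matching its first `n` ghost components are corrected by
multiples of `D_n = ∏_{m<n} (t^{1/p^m} - p)`: `π(φ^i D_n)` vanishes for `i < n` and is `p^n` times a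
unit for `i = n`. Modulo `p`, `D_n` is a power of `t` with exponent `1 + ⋯ + 1/p^{n-1}`. These
exponents are bounded, so the `b_n` need not converge, but spherical completeness still gives `c`
with `c - b_n` in `(D_n, p)` for all `n`. Writing `c = φ(d)`, with `x` the Witt vector of `d`, gives
`y = F(x) + p w = F(x + V w)`; see `frobenius_surjective_of_lift`.

The truncated and Teichmüller conditions follow from surjectivity of `F`. The others use that `I_n`
is generated by `p^{1/p + ⋯ + 1/p^n}` (`mem_frobIdeal_iff`), spherical completeness again, and
`p`-th roots modulo `p`. -/

namespace WittFrobenius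

/-! ### Divisibility and spherical completeness of generalized power series -/

section Coefficients

open HahnSeries

variable {A : Type*} [CommRing A]

theorem coeff_single_mul_of_lt {a i : ℚ≥0} (h : i < a) (r : A) (x : GenPowerSeries A) :
    (single a r * x).coeff i = 0 := by
  by_contra hne
  obtain ⟨j, hj, k, -, rfl⟩ := support_mul_subset ((mem_support _ _).2 hne)
  rw [eq_of_mem_support_single hj] at h
  exact absurd h (not_lt.2 le_self_add)

theorem coeff_single_mul_of_le {a i : ℚ≥0} (h : a ≤ i) (r : A) (x : GenPowerSeries A) :
    (single a r * x).coeff i = r * x.coeff (i - a) := by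
  conv_lhs => rw [← tsub_add_cancel_of_le h]
  exact coeff_single_mul_add

theorem single_dvd_of_coeff_eq_zero {a : ℚ≥0} {b : GenPowerSeries A}
    (h : ∀ i < a, b.coeff i = 0) : single a 1 ∣ b := by
  have hmono : StrictMono fun i : ℚ≥0 => i + a := fun _ _ hij => add_lt_add_left hij a
  refine ⟨⟨fun i => b.coeff (i + a), ?_⟩, ?_⟩
  · rw [Set.isPWO_iff_isWF]
    refine Set.isWF_iff_no_descending_seq.2 fun f hf hmem => ?_
    refine Set.isWF_iff_no_descending_seq.1 b.isWF_support (fun n => f n + a)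
      (fun m n hmn => hmono (hf hmn)) fun n => ?_
    exact hmem n
  · ext i
    rcases lt_or_ge i a with hi | hi
    · rw [h i hi, coeff_single_mul_of_lt hi]
    · rw [coeff_single_mul_of_le hi, one_mul]
      simp only [tsub_add_cancel_of_le hi]

theorem coeff_natCast_mul (n : ℕ) (b : GenPowerSeries A) (i : ℚ≥0) :
    ((n : GenPowerSeries A) * b).coeff i = n * b.coeff i := by
  rw [← nsmul_eq_mul, coeff_smul, nsmul_eq_mul]

theorem natCast_dvd_of_dvd_coeff {n : ℕ} {b : GenPowerSeries A}
    (h : ∀ i, (n : A) ∣ b.coeff i) : (n : GenPowerSeries A) ∣ b := by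
  classical
  -- The quotient is chosen to vanish wherever `b` does, so that its support stays well-ordered.
  have h' : ∀ i, ∃ c, b.coeff i = n * c ∧ (b.coeff i = 0 → c = 0) := fun i => by
    by_cases hi : b.coeff i = 0
    · exact ⟨0, by simp [hi], fun _ => rfl⟩
    · obtain ⟨c, hc⟩ := h i
      exact ⟨c, hc, fun h0 => absurd h0 hi⟩
  choose c hc hc0 using h'
  refine ⟨⟨c, b.isPWO_support.mono fun i hi h0 => hi (hc0 i h0)⟩, ?_⟩
  ext i
  rw [coeff_natCast_mul]
  exact hc i

/-- Successive approximations that agree up to increasing exponents have a common limit. -/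
theorem exists_limit_of_dvd (γ : ℕ → ℚ≥0) (hγ : Monotone γ) (b : ℕ → GenPowerSeries A)
    (hb : ∀ n, single (γ n) 1 ∣ b (n + 1) - b n) :
    ∃ c : GenPowerSeries A, ∀ n, single (γ n) 1 ∣ c - b n := by
  classical
  have hcoeff : ∀ m n, m ≤ n → ∀ i < γ m, (b n).coeff i = (b m).coeff i := by
    intro m n hmn i hi
    induction n, hmn using Nat.le_induction with
    | base => rfl
    | succ n hmn ih =>
      obtain ⟨d, hd⟩ := hb n
      rw [← ih, ← sub_eq_zero, ← coeff_sub, hd]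
      exact coeff_single_mul_of_lt (hi.trans_le (hγ hmn)) _ _
  -- Exponents beyond every `γ n` get coefficient 0; no unboundedness of `γ` is needed.
  let f : ℚ≥0 → A := fun i => if h : ∃ n, i < γ n then (b (Nat.find h)).coeff i else 0
  have hf : ∀ n, ∀ i < γ n, f i = (b n).coeff i := by
    intro n i hi
    have h : ∃ n, i < γ n := ⟨n, hi⟩
    simp only [f, dif_pos h]
    exact (hcoeff _ _ (Nat.find_min' h hi) i (Nat.find_spec h)).symm
  -- A descending sequence starting below `γ n` stays there, hence in the support of `b n`.
  have hpwo : (Function.support f).IsPWO := by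
    rw [Set.isPWO_iff_isWF]
    refine Set.isWF_iff_no_descending_seq.2 fun g hg hmem => ?_
    have h0 : ∃ n, g 0 < γ n := by
      by_contra h0
      exact hmem 0 (dif_neg h0)
    obtain ⟨n, hn⟩ := h0
    refine Set.isWF_iff_no_descending_seq.1 (b n).isWF_support g hg fun k => ?_
    have := hmem k
    rw [Function.mem_support, hf n _ ((hg.antitone (Nat.zero_le k)).trans_lt hn)] at this
    exact this
  refine ⟨⟨f, hpwo⟩, fun n => single_dvd_of_coeff_eq_zero fun i hi => ?_⟩
  rw [coeff_sub, sub_eq_zero]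
  exact hf n i hi

end Coefficients

/-! ### The Frobenius lift on generalized power series -/

section Frobenius

open HahnSeries

variable {p : ℕ} [hp : Fact p.Prime]

theorem coeff_pow_of_support_lt {A : Type*} [CommRing A] {x : GenPowerSeries A} {c : ℚ≥0}
    (h : ∀ i, x.coeff i ≠ 0 → i < c) {n : ℕ} (hn : n ≠ 0) {i : ℚ≥0} (hi : n * c ≤ i) :
    (x ^ n).coeff i = 0 := by
  have key : ∀ n : ℕ, ∀ i, (x ^ (n + 1)).coeff i ≠ 0 → i < (n + 1 : ℕ) * c := by
    intro n
    induction n with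
    | zero => simpa using h
    | succ n ih =>
      intro i hi
      rw [pow_succ] at hi
      obtain ⟨j, hj, k, hk, rfl⟩ := support_mul_subset ((mem_support _ _).2 hi)
      rw [Nat.cast_succ, add_mul, one_mul]
      exact add_lt_add (ih j hj) (h k hk)
  obtain ⟨m, rfl⟩ := Nat.exists_eq_succ_of_ne_zero hn
  by_contra hne
  exact absurd (key m i hne) (not_lt.2 hi)

theorem coeff_pow_of_lt_support {A : Type*} [CommRing A] {x : GenPowerSeries A} {c : ℚ≥0}
    (h : ∀ i, x.coeff i ≠ 0 → c < i) {n : ℕ} (hn : n ≠ 0) {i : ℚ≥0} (hi : i ≤ n * c) :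
    (x ^ n).coeff i = 0 := by
  have key : ∀ n : ℕ, ∀ i, (x ^ (n + 1)).coeff i ≠ 0 → (n + 1 : ℕ) * c < i := by
    intro n
    induction n with
    | zero => simpa using h
    | succ n ih =>
      intro i hi
      rw [pow_succ] at hi
      obtain ⟨j, hj, k, hk, rfl⟩ := support_mul_subset ((mem_support _ _).2 hi)
      rw [Nat.cast_succ, add_mul, one_mul]
      exact add_lt_add (ih j hj) (h k hk)
  obtain ⟨m, rfl⟩ := Nat.exists_eq_succ_of_ne_zero hn
  by_contra hne
  exact absurd (key m i hne) (not_lt.2 hi)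

/-- The `p`-th power of a generalized power series in characteristic `p`. -/
theorem coeff_pow_char {k : Type*} [CommRing k] [CharP k p] (x : GenPowerSeries k) (i : ℚ≥0) :
    (x ^ p).coeff (p * i) = x.coeff i ^ p := by
  classical
  have : CharP (GenPowerSeries k) p := charP_of_injective_ringHom (f := C) C_injective p
  have hp0 := hp.out.ne_zero
  -- Split `x` into its parts below, at and above exponent `i`; the `p`-th power is additive, and
  -- only the middle part reaches exponent `p i`.
  set u := truncLT i x
  set v : GenPowerSeries k := single i (x.coeff i)
  set w := x - u - v
  have hx : x = u + v + w := by simp [w]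
  have hw : ∀ j, w.coeff j ≠ 0 → i < j := by
    intro j hj
    by_contra hij
    refine hj ?_
    rcases lt_or_eq_of_le (not_lt.1 hij) with h | rfl
    · simp [w, u, v, coeff_truncLT_of_lt h, coeff_single_of_ne h.ne]
    · simp [w, u, v]
  have hu : ∀ j, u.coeff j ≠ 0 → j < i := by
    intro j hj
    by_contra hij
    exact hj (coeff_truncLT_of_le (not_lt.1 hij) x)
  rw [hx, add_pow_char, add_pow_char, coeff_add, coeff_add,
    coeff_pow_of_support_lt hu hp0 le_rfl, coeff_pow_of_lt_support hw hp0 le_rfl, single_pow,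
    nsmul_eq_mul, coeff_single_same, ← hx, zero_add, add_zero]

/-- The ring homomorphism that applies `f` to every coefficient. -/
noncomputable def mapCoeff {A k : Type*} [CommRing A] [CommRing k] (f : A →+* k) :
    GenPowerSeries A →+* GenPowerSeries k where
  toFun x := x.map f
  map_one' := HahnSeries.map_one f.toMonoidWithZeroHom
  map_mul' _ _ := HahnSeries.map_mul f.toNonUnitalRingHom
  map_zero' := HahnSeries.map_zero f.toMonoidWithZeroHom.toZeroHom
  map_add' _ _ := HahnSeries.map_add f.toAddMonoidHom

/-- The map `∑ c_i t^i ↦ ∑ σ(c_i) t^{pi}`. -/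
noncomputable def frobLift (p : ℕ) [hp : Fact p.Prime] {A : Type*} [CommRing A] (σ : A →+* A) :
    GenPowerSeries A →+* GenPowerSeries A :=
  (embDomainRingHom (AddMonoidHom.mulLeft (p : ℚ≥0))
    (mul_right_injective₀ (Nat.cast_ne_zero.2 hp.out.ne_zero)) (fun _ _ =>
      mul_le_mul_iff_right₀ (Nat.cast_pos.2 hp.out.pos))).comp
    (mapCoeff σ)

variable {A : Type*} [CommRing A]

theorem coeff_frobLift (σ : A →+* A) (b : GenPowerSeries A) (i : ℚ≥0) :
    (frobLift p σ b).coeff (p * i) = σ (b.coeff i) :=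
  embDomain_mk_coeff (f := AddMonoidHom.mulLeft (p : ℚ≥0))
    (mul_right_injective₀ (Nat.cast_ne_zero.2 hp.out.ne_zero)) (fun _ _ =>
      mul_le_mul_iff_right₀ (Nat.cast_pos.2 hp.out.pos)) (x := mapCoeff σ b) (a := i)

theorem natCast_mul_div_self (i : ℚ≥0) : (p : ℚ≥0) * (i / p) = i :=
  mul_div_cancel₀ i (Nat.cast_ne_zero.2 hp.out.ne_zero)

theorem coeff_frobLift_eq (σ : A →+* A) (b : GenPowerSeries A) (i : ℚ≥0) :
    (frobLift p σ b).coeff i = σ (b.coeff (i / p)) := by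
  rw [← coeff_frobLift (p := p), natCast_mul_div_self]

theorem frobLift_surjective {σ : A →+* A} (hσ : Function.Bijective σ) :
    Function.Surjective (frobLift p σ) := by
  intro b
  choose τ hτ using hσ.2
  -- `τ` is a bare choice of preimages; fixing 0 is what controls the support.
  have hτ0 : τ 0 = 0 := hσ.1 (by rw [hτ, map_zero])
  have hpos : (0 : ℚ≥0) < p := Nat.cast_pos.2 hp.out.pos
  refine ⟨⟨fun i => τ (b.coeff (p * i)), ?_⟩, ?_⟩
  · rw [Set.isPWO_iff_isWF]
    refine Set.isWF_iff_no_descending_seq.2 fun f hf hmem => ?_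
    refine Set.isWF_iff_no_descending_seq.1 b.isWF_support (fun n => p * f n)
      (fun m n hmn => mul_lt_mul_of_pos_left (hf hmn) hpos) fun n h0 => ?_
    refine hmem n ?_
    simp only [h0, hτ0]
  · ext i
    rw [coeff_frobLift_eq, hτ, natCast_mul_div_self]

theorem frobLift_single (σ : A →+* A) (i : ℚ≥0) :
    frobLift p σ (single i 1) = single (p * i) 1 := by
  ext j
  rw [coeff_frobLift_eq, coeff_single, coeff_single]
  have : j / p = i ↔ j = p * i := by
    rw [div_eq_iff (Nat.cast_ne_zero.2 hp.out.ne_zero), mul_comm]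
  simp only [this]
  split_ifs <;> simp

/-- Over `A/p`, of characteristic `p` because `p` is not a unit, both terms have coefficient
`b_{i/p}^p` at exponent `i`. -/
theorem natCast_dvd_frobLift_sub_pow {σ : A →+* A} (hA : ¬ IsUnit (p : A))
    (hσ : ∀ a, (p : A) ∣ σ a - a ^ p) (b : GenPowerSeries A) :
    (p : GenPowerSeries A) ∣ frobLift p σ b - b ^ p := by
  have : CharP (A ⧸ Ideal.span {(p : A)}) p := CharP.quotient A p hA
  refine natCast_dvd_of_dvd_coeff fun i => ?_
  let q : A →+* A ⧸ Ideal.span {(p : A)} := Ideal.Quotient.mk _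
  have hq : ∀ a, q a = 0 ↔ (p : A) ∣ a := fun a => by
    rw [Ideal.Quotient.eq_zero_iff_mem, Ideal.mem_span_singleton]
  have h1 : q ((b ^ p).coeff i) = q (b.coeff (i / p) ^ p) := by
    have := coeff_pow_char (p := p) (mapCoeff q b) (i / p)
    rw [natCast_mul_div_self, ← map_pow] at this
    rw [map_pow]
    exact this
  rw [← hq, coeff_sub, coeff_frobLift_eq, map_sub, h1, ← map_sub, hq]
  exact hσ _

end Frobenius

/-! ### Dwork's lemma -/

section Lambda

theorem natCast_pow_mul_cancel {p : ℕ} {R : Type*} [CommRing R]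
    (hR : ∀ r : R, (p : R) * r = 0 → r = 0) (n : ℕ) {r s : R}
    (h : (p : R) ^ n * r = (p : R) ^ n * s) : r = s := by
  induction n with
  | zero => simpa using h
  | succ n ih =>
    rw [pow_succ', mul_assoc, mul_assoc, ← sub_eq_zero, ← mul_sub] at h
    exact ih (sub_eq_zero.1 (hR _ h))

variable {p : ℕ} {B : Type*} [CommRing B]

/-- The Witt vector components of the sequence of ghost components `b, φ(b), φ²(b), …`. -/
noncomputable def lambdaCoeff (p : ℕ) (φ : B →+* B) (b : B) : ℕ → B
  | n => Classical.epsilon fun v : B =>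
      ∑ i : Fin n, (p : B) ^ (i : ℕ) * lambdaCoeff p φ b i ^ p ^ (n - i) + (p : B) ^ n * v =
        φ^[n] b

/-- Applying `φ` to the identity at level `n` gives the one at level `n + 1` modulo `p^{n+1}`, so
the equation defining the next component is solvable. -/
theorem sum_lambdaCoeff {φ : B →+* B} (hφ : ∀ b, (p : B) ∣ φ b - b ^ p) (b : B) (n : ℕ) :
    ∑ i ∈ Finset.range (n + 1), (p : B) ^ i * lambdaCoeff p φ b i ^ p ^ (n - i) = φ^[n] b := by
  induction n with
  | zero =>
    rw [zero_add, Finset.sum_range_one, lambdaCoeff]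
    have := Classical.epsilon_spec (p := fun v : B =>
      ∑ i : Fin 0, (p : B) ^ (i : ℕ) * lambdaCoeff p φ b i ^ p ^ (0 - (i : ℕ)) + (p : B) ^ 0 * v =
        φ^[0] b) ⟨b, by simp⟩
    simpa using this
  | succ n ih =>
    have hdvd : (p : B) ^ (n + 1) ∣ φ^[n + 1] b -
        ∑ i ∈ Finset.range (n + 1), (p : B) ^ i * lambdaCoeff p φ b i ^ p ^ (n + 1 - i) := by
      rw [Function.iterate_succ_apply', ← ih, map_sum, ← Finset.sum_sub_distrib]
      refine Finset.dvd_sum fun i hi => ?_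
      have hi' : i ≤ n := Nat.lt_succ_iff.1 (Finset.mem_range.1 hi)
      rw [map_mul, map_pow, map_pow, map_natCast, ← mul_sub, Nat.succ_sub hi',
        pow_succ' p, pow_mul]
      -- A congruence modulo `p` becomes one modulo `p^{n-i+1}` after raising to the power
      -- `p^{n-i}`.
      have := mul_dvd_mul_left ((p : B) ^ i)
        (dvd_sub_pow_of_dvd_sub (hφ (lambdaCoeff p φ b i)) (n - i))
      rwa [← pow_add, show i + (n - i + 1) = n + 1 by omega] at this
    obtain ⟨v, hv⟩ := hdvd
    have := Classical.epsilon_spec (p := fun v : B =>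
      ∑ i : Fin (n + 1), (p : B) ^ (i : ℕ) * lambdaCoeff p φ b i ^ p ^ (n + 1 - i) +
        (p : B) ^ (n + 1) * v = φ^[n + 1] b)
        ⟨v, by
          rw [Fin.sum_univ_eq_sum_range
            (fun i => (p : B) ^ i * lambdaCoeff p φ b i ^ p ^ (n + 1 - i)), ← hv]
          ring⟩
    rw [← lambdaCoeff, Fin.sum_univ_eq_sum_range
      (fun i => (p : B) ^ i * lambdaCoeff p φ b i ^ p ^ (n + 1 - i))] at this
    rw [Finset.sum_range_succ, Nat.sub_self, pow_zero, pow_one]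
    exact this

end Lambda

/-! ### Ghost components and the surjectivity criterion -/

section Ghost

variable {p : ℕ} [hp : Fact p.Prime] {R : Type*} [CommRing R]

open WittVector

theorem ghostComponent_eq_sum (n : ℕ) (x : WittVector p R) :
    ghostComponent n x =
      ∑ i ∈ Finset.range (n + 1), (p : R) ^ i * x.coeff i ^ p ^ (n - i) := by
  rw [ghostComponent_apply, aeval_wittPolynomial]

theorem ghostComponent_congr {x y : WittVector p R} {n : ℕ}
    (h : ∀ i ≤ n, x.coeff i = y.coeff i) : ghostComponent n x = ghostComponent n y := by
  rw [ghostComponent_eq_sum, ghostComponent_eq_sum]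
  refine Finset.sum_congr rfl fun i hi => ?_
  rw [h i (Nat.lt_succ_iff.1 (Finset.mem_range.1 hi))]

/-- Without `p`-torsion, the ghost components determine the components. -/
theorem coeff_eq_of_ghostComponent_eq (hR : ∀ r : R, (p : R) * r = 0 → r = 0)
    {x y : WittVector p R} {n : ℕ} (h : ∀ i < n, ghostComponent i x = ghostComponent i y) :
    ∀ i < n, x.coeff i = y.coeff i := by
  intro i
  induction i using Nat.strong_induction_on with
  | _ i ih =>
    intro hi
    have := h i hi
    rw [ghostComponent_eq_sum, ghostComponent_eq_sum, Finset.sum_range_succ,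
      Finset.sum_range_succ, Finset.sum_congr rfl fun j hj => by
        rw [ih j (Finset.mem_range.1 hj) ((Finset.mem_range.1 hj).trans hi)]] at this
    simpa using natCast_pow_mul_cancel hR i (add_left_cancel this)

theorem eq_of_ghostComponent_eq (hR : ∀ r : R, (p : R) * r = 0 → r = 0)
    {x y : WittVector p R} (h : ∀ i, ghostComponent i x = ghostComponent i y) : x = y := by
  ext i
  exact coeff_eq_of_ghostComponent_eq hR (fun j _ => h j) i (Nat.lt_succ_self i)

/-- Approximate quotients by `p` have the same ghost components as far as both are valid, so their
components agree there and glue. -/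
theorem exists_eq_natCast_mul (hR : ∀ r : R, (p : R) * r = 0 → r = 0) (z : WittVector p R)
    (h : ∀ n, ∃ w : WittVector p R, ∀ i < n, ghostComponent i z = p * ghostComponent i w) :
    ∃ w : WittVector p R, z = p * w := by
  choose w hw using h
  have hc : ∀ m n, m ≤ n → ∀ i < m, (w m).coeff i = (w n).coeff i := fun m n hmn =>
    coeff_eq_of_ghostComponent_eq hR fun i hi => sub_eq_zero.1 <| hR _ <| by
      rw [mul_sub, ← hw m i hi, ← hw n i (hi.trans_le hmn), sub_self]
  let v : WittVector p R := WittVector.mk p fun i => (w (i + 1)).coeff i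
  refine ⟨v, eq_of_ghostComponent_eq hR fun i => ?_⟩
  rw [map_mul, map_natCast, hw (i + 1) i (Nat.lt_succ_self i)]
  congr 1
  refine ghostComponent_congr fun j hj => ?_
  exact (hc (j + 1) (i + 1) (Nat.succ_le_succ hj) j (Nat.lt_succ_self j)).symm

variable {B : Type*} [CommRing B]

theorem exists_ghostComponent_eq {φ : B →+* B} (hφ : ∀ b, (p : B) ∣ φ b - b ^ p) (π : B →+* R)
    (b : B) : ∃ x : WittVector p R, ∀ n, ghostComponent n x = π (φ^[n] b) := by
  refine ⟨WittVector.mk p fun i => π (lambdaCoeff p φ b i), fun n => ?_⟩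
  rw [ghostComponent_eq_sum, ← sum_lambdaCoeff hφ, map_sum]
  refine Finset.sum_congr rfl fun i _ => ?_
  rw [map_mul, map_pow, map_pow, map_natCast, coeff_mk]

/-- Surjectivity of the Witt vector Frobenius of a quotient of a ring with a surjective Frobenius
lift, given elements `D n` whose multiples describe the congruences between approximations of
a Witt vector and a completeness property with respect to these congruences modulo `p`. -/
theorem frobenius_surjective_of_lift {φ : B →+* B} (hφ : ∀ b, (p : B) ∣ φ b - b ^ p)
    (hφs : Function.Surjective φ) {π : B →+* R} (hπ : Function.Surjective π)
    (hR : ∀ r : R, (p : R) * r = 0 → r = 0) (D : ℕ → B)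
    (hD : ∀ n, ∀ i < n, π (φ^[i] (D n)) = 0)
    (hDu : ∀ n, ∃ u : R, IsUnit u ∧ π (φ^[n] (D n)) = p ^ n * u)
    (hlim : ∀ b e : ℕ → B, (∀ n, b (n + 1) = b n + D n * e n) →
      ∃ (c : B) (f g : ℕ → B), ∀ n, c - b n = D n * f n + p * g n) :
    Function.Surjective (frobenius : WittVector p R →+* WittVector p R) := by
  intro y
  have hstep : ∀ n b, (∀ i < n, ghostComponent i y = π (φ^[i] b)) →
      ∃ e, ∀ i < n + 1, ghostComponent i y = π (φ^[i] (b + D n * e)) := by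
    intro n b hb
    obtain ⟨x, hx⟩ := exists_ghostComponent_eq hφ π b
    have hxy := coeff_eq_of_ghostComponent_eq hR
      (fun i hi => (hb i hi).trans (hx i).symm)
    obtain ⟨u, hu, hDn⟩ := hDu n
    obtain ⟨v, hv⟩ := hu.exists_right_inv
    obtain ⟨e', he'⟩ := hπ (v * (y.coeff n - x.coeff n))
    obtain ⟨e, rfl⟩ := hφs.iterate n e'
    -- The first `n` components already agree, so the `n`-th ghost components differ by `p^n (y_n -
    -- x_n)`; `e` was chosen to cancel this.
    refine ⟨e, fun i hi => ?_⟩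
    rw [iterate_map_add, iterate_map_mul, map_add, map_mul]
    rcases Nat.lt_succ_iff_lt_or_eq.1 hi with hi | rfl
    · rw [hD n i hi, zero_mul, add_zero, hb i hi]
    · rw [hDn, he', ← hx, ghostComponent_eq_sum, ghostComponent_eq_sum, Finset.sum_range_succ,
        Finset.sum_range_succ, Finset.sum_congr rfl fun j hj => by
          rw [hxy j (Finset.mem_range.1 hj)]]
      simp only [Nat.sub_self, pow_zero, pow_one]
      linear_combination (p : R) ^ i * (x.coeff i - y.coeff i) * hv
  choose e he using hstep
  let s : ∀ n, {b : B // ∀ i < n, ghostComponent i y = π (φ^[i] b)} := fun n =>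
    Nat.rec ⟨0, fun i hi => absurd hi (Nat.not_lt_zero i)⟩
      (fun n b => ⟨b.1 + D n * e n b.1 b.2, he n b.1 b.2⟩) n
  obtain ⟨c, f, g, hc⟩ := hlim (fun n => (s n).1) (fun n => e n (s n).1 (s n).2) fun _ => rfl
  obtain ⟨d, rfl⟩ := hφs c
  obtain ⟨x, hx⟩ := exists_ghostComponent_eq hφ π d
  -- Below `n`, the `i`-th ghost component of `y - F x` is `π(φ^i(b_n - c)) = -p π(φ^i(g_n))`, since
  -- `D_n` dies.
  obtain ⟨w, hw⟩ := exists_eq_natCast_mul hR (y - frobenius x) fun n => by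
    obtain ⟨w, hw⟩ := exists_ghostComponent_eq hφ π (-g n)
    refine ⟨w, fun i hi => ?_⟩
    have h : φ d = (s n).1 + (D n * f n + p * g n) := by rw [← hc n]; ring
    rw [map_sub, ghostComponent_frobenius, hx, Function.iterate_succ_apply, h, hw,
      (s n).2 i hi, iterate_map_add, iterate_map_add, iterate_map_mul, iterate_map_mul,
      map_add, map_add, map_mul, map_mul, hD n i hi, iterate_map_neg, map_neg,
      ← RingHom.coe_pow, map_natCast, map_natCast]
    ring
  refine ⟨x + verschiebung w, ?_⟩
  rw [map_add, frobenius_verschiebung, mul_comm, ← hw]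
  ring

theorem frobenius_teichmuller (hR : ∀ r : R, (p : R) * r = 0 → r = 0) (r : R) :
    frobenius (teichmuller p r) = teichmuller p (r ^ p) :=
  eq_of_ghostComponent_eq hR fun i => by
    rw [ghostComponent_frobenius, ghostComponent_teichmuller, ghostComponent_teichmuller,
      ← pow_mul, pow_succ']

theorem exists_eq_teichmuller_add_verschiebung (x : WittVector p R) :
    ∃ (r : R) (y : WittVector p R), x = teichmuller p r + verschiebung y := by
  refine ⟨x.coeff 0, WittVector.mk p fun n => x.coeff (n + 1), ?_⟩
  ext n
  rw [coeff_add_of_disjoint]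
  · cases n with
    | zero => simp [teichmuller_coeff_zero]
    | succ n => simp [teichmuller_coeff_pos]
  · intro n
    cases n with
    | zero => exact Or.inr (verschiebung_coeff_zero _)
    | succ n => exact Or.inl (teichmuller_coeff_pos _ _ _ (Nat.succ_pos n))

/-- `F([r] + V y) = [r^p] + p y`. -/
theorem teichDense_of_frobSurj (hR : ∀ r : R, (p : R) * r = 0 → r = 0) (hF : FrobSurj p R) :
    TeichDense p R := by
  intro x
  obtain ⟨z, rfl⟩ := hF x
  obtain ⟨r, y, rfl⟩ := exists_eq_teichmuller_add_verschiebung z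
  refine ⟨r ^ p, y, ?_⟩
  rw [map_add, frobenius_teichmuller hR, frobenius_verschiebung]
  ring

theorem truncFrobenius_surjective (hF : FrobSurj p R) (n : ℕ) :
    Function.Surjective (truncFrobenius p R n) := by
  intro y
  obtain ⟨y, rfl⟩ := WittVector.truncate_surjective p n R y
  obtain ⟨x, rfl⟩ := hF y
  exact ⟨_, truncFrobenius_truncate p n x⟩

theorem truncFrobeniusIter_surjective (hF : FrobSurj p R) (n : ℕ) :
    Function.Surjective (truncFrobeniusIter p R n) := by
  induction n with
  | zero => exact Function.surjective_id
  | succ n ih =>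
    rw [truncFrobeniusIter, RingHom.coe_comp]
    exact ih.comp (truncFrobenius_surjective hF (n + 1))

end Ghost

/-! ### The exponents `1 + 1/p + ⋯ + 1/p^{n-1}` -/

section Exponents

variable (p : ℕ)

/-- `1 + 1/p + ⋯ + 1/p^{n-1}`. -/
def geomExp (n : ℕ) : ℚ≥0 := ∑ i ∈ Finset.range n, (p ^ i : ℚ≥0)⁻¹

theorem geomExp_monotone : Monotone (geomExp p) :=
  monotone_nat_of_le_succ fun n => by
    rw [geomExp, geomExp, Finset.sum_range_succ]
    exact le_self_add

theorem geomExp_succ (n : ℕ) : geomExp p (n + 1) = 1 + geomExp p n / p := by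
  rw [geomExp, geomExp, Finset.sum_range_succ', Finset.sum_div, add_comm]
  congr 1
  · simp
  · refine Finset.sum_congr rfl fun i _ => ?_
    rw [pow_succ, mul_inv, div_eq_mul_inv]

end Exponents

/-! ### Surjectivity of `F` for Poonen's ring -/

section Poonen

open HahnSeries

variable {p : ℕ} {A : Type*} [CommRing A]

/-- The projection `A⟦t^ℚ⟧ → A⟦t^ℚ⟧ / (t - p)`. -/
noncomputable abbrev toPoonen (p : ℕ) (A : Type*) [CommRing A] :
    GenPowerSeries A →+* PoonenRing p A :=
  Ideal.Quotient.mk _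

theorem toPoonen_surjective : Function.Surjective (toPoonen p A) :=
  Ideal.Quotient.mk_surjective

theorem toPoonen_eq_zero_iff (b : GenPowerSeries A) :
    toPoonen p A b = 0 ↔ single (1 : ℚ≥0) (1 : A) - (p : GenPowerSeries A) ∣ b := by
  rw [Ideal.Quotient.eq_zero_iff_mem, Ideal.mem_span_singleton]

theorem toPoonen_single_one : toPoonen p A (single 1 1) = p := by
  rw [← sub_eq_zero, ← map_natCast (toPoonen p A), ← map_sub, toPoonen_eq_zero_iff]

theorem toPoonen_single_natCast (n : ℕ) : toPoonen p A (single (n : ℚ≥0) 1) = p ^ n := by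
  rw [← toPoonen_single_one, ← map_pow, single_pow, one_pow, nsmul_one]

/-- In the quotient `p` is `t`. If `t b = (t - p) c`, then `t` divides `p c`, hence `c`, and `t`
cancels. -/
theorem eq_zero_of_natCast_mul_eq_zero (hA : ∀ a : A, (p : A) * a = 0 → a = 0)
    (r : PoonenRing p A) (h : (p : PoonenRing p A) * r = 0) : r = 0 := by
  obtain ⟨b, rfl⟩ := toPoonen_surjective r
  rw [← toPoonen_single_one, ← map_mul, toPoonen_eq_zero_iff] at h
  obtain ⟨c, hc⟩ := h
  have h1 : single (1 : ℚ≥0) (1 : A) ∣ c := by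
    refine single_dvd_of_coeff_eq_zero fun i hi => hA _ ?_
    have : (p : GenPowerSeries A) * c = single 1 1 * (c - b) := by linear_combination hc
    rw [← coeff_natCast_mul, this, coeff_single_mul_of_lt hi]
  obtain ⟨d, rfl⟩ := h1
  rw [toPoonen_eq_zero_iff]
  refine ⟨d, sub_eq_zero.1 ?_⟩
  have h2 : single (1 : ℚ≥0) (1 : A) * (b - (single 1 1 - (p : GenPowerSeries A)) * d) = 0 := by
    linear_combination hc
  ext i
  have h3 := congrArg (fun x => x.coeff (i + 1)) h2
  simpa [coeff_single_mul_add] using h3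

theorem not_pInvertible (hA : ¬ IsUnit (p : A)) : ¬ PInvertible p (PoonenRing p A) := by
  intro h
  obtain ⟨r, hr⟩ := h.exists_right_inv
  obtain ⟨b, rfl⟩ := toPoonen_surjective r
  rw [← sub_eq_zero, ← toPoonen_single_one, ← map_mul, ← map_one (toPoonen p A), ← map_sub,
    toPoonen_eq_zero_iff] at hr
  obtain ⟨c, hc⟩ := hr
  have h1 : (1 : GenPowerSeries A) = single 1 1 * (b - c) +
      (p : GenPowerSeries A) * c := by linear_combination -hc
  -- The constant coefficient would make `p` a unit of `A`.
  have h2 := congrArg (fun x : GenPowerSeries A => x.coeff 0) h1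
  simp only [coeff_add, coeff_natCast_mul, coeff_single_mul_of_lt one_pos, zero_add,
    coeff_one, if_pos] at h2
  exact hA (IsUnit.of_mul_eq_one _ h2.symm)

theorem iterate_frobLift_single [hp : Fact p.Prime] (σ : A →+* A) (n : ℕ) (i : ℚ≥0) :
    (frobLift p σ)^[n] (single i 1) = single (p ^ n * i) 1 := by
  induction n with
  | zero => simp
  | succ n ih => rw [Function.iterate_succ_apply', ih, frobLift_single, pow_succ', mul_assoc]

/-- The product of the `t^{1/p^m} - p` for `m < n`. -/
noncomputable def distProd (p : ℕ) (A : Type*) [CommRing A] (n : ℕ) : GenPowerSeries A :=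
  ∏ m ∈ Finset.range n, (single ((p ^ m : ℚ≥0)⁻¹) 1 - (p : GenPowerSeries A))

theorem natCast_dvd_distProd_sub_single (n : ℕ) :
    (p : GenPowerSeries A) ∣ distProd p A n - single (geomExp p n) 1 := by
  induction n with
  | zero => simp [distProd, geomExp]
  | succ n ih =>
    obtain ⟨d, hd⟩ := ih
    have h : single (geomExp p (n + 1)) (1 : A) =
        single (geomExp p n) 1 * single ((p ^ n : ℚ≥0)⁻¹) 1 := by
      rw [single_mul_single, one_mul, geomExp, geomExp, Finset.sum_range_succ]
    refine ⟨d * single ((p ^ n : ℚ≥0)⁻¹) 1 - distProd p A n, ?_⟩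
    rw [h, distProd, Finset.prod_range_succ, ← distProd]
    linear_combination single ((p ^ n : ℚ≥0)⁻¹) 1 * hd

theorem iterate_frobLift_distProd [hp : Fact p.Prime] (σ : A →+* A) (n i : ℕ) :
    (frobLift p σ)^[i] (distProd p A n) =
      ∏ m ∈ Finset.range n, (single (p ^ i * (p ^ m : ℚ≥0)⁻¹) 1 - (p : GenPowerSeries A)) := by
  rw [← RingHom.coe_pow, distProd, map_prod]
  refine Finset.prod_congr rfl fun m _ => ?_
  rw [map_sub, map_natCast, RingHom.coe_pow, iterate_frobLift_single]

theorem toPoonen_iterate_frobLift_distProd_eq_zero [hp : Fact p.Prime]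
    (σ : A →+* A) {n i : ℕ} (hi : i < n) :
    toPoonen p A ((frobLift p σ)^[i] (distProd p A n)) = 0 := by
  rw [iterate_frobLift_distProd, map_prod]
  -- The factor with `m = i` has become `t - p`.
  refine Finset.prod_eq_zero (Finset.mem_range.2 hi) ?_
  rw [mul_inv_cancel₀ (pow_ne_zero _ (Nat.cast_ne_zero.2 hp.out.ne_zero)), map_sub, map_natCast,
    toPoonen_single_one, sub_self]

/-- Each factor maps to `p^{p^{n-m}} - p = p (p^{p^{n-m}-1} - 1)`, and the bracket is a unit because
`A` is local with `p` in its maximal ideal. -/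
theorem exists_isUnit_toPoonen_iterate_frobLift_distProd [hp : Fact p.Prime]
    [IsLocalRing A] (hA : ¬ IsUnit (p : A)) (σ : A →+* A) (n : ℕ) :
    ∃ u, IsUnit u ∧ toPoonen p A ((frobLift p σ)^[n] (distProd p A n)) = p ^ n * u := by
  have hunit : ∀ k : ℕ, k ≠ 0 → IsUnit ((p : PoonenRing p A) ^ k - 1) := by
    intro k hk
    have h : IsUnit (1 - (p : A) ^ k) :=
      IsLocalRing.isUnit_one_sub_self_of_mem_nonunits _ fun h => hA ((isUnit_pow_iff hk).1 h)
    have := (h.map ((toPoonen p A).comp C)).neg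
    simpa only [map_sub, map_one, map_pow, map_natCast, neg_sub] using this
  refine ⟨∏ m ∈ Finset.range n, ((p : PoonenRing p A) ^ (p ^ (n - m) - 1) - 1), ?_, ?_⟩
  · refine IsUnit.prod_iff.2 fun m hm => hunit _ ?_
    have hm' := Finset.mem_range.1 hm
    exact Nat.sub_ne_zero_of_lt (Nat.one_lt_pow (Nat.sub_ne_zero_of_lt hm') hp.out.one_lt)
  · rw [iterate_frobLift_distProd, map_prod]
    conv_rhs => rw [← Finset.card_range n, ← Finset.prod_const, Finset.card_range,
      ← Finset.prod_mul_distrib]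
    refine Finset.prod_congr rfl fun m hm => ?_
    have hm' := (Finset.mem_range.1 hm).le
    have hexp : (p ^ n * (p ^ m : ℚ≥0)⁻¹) = (p ^ (n - m) : ℕ) := by
      rw [Nat.cast_pow, pow_sub₀ _ (Nat.cast_ne_zero.2 hp.out.ne_zero) hm']
    rw [hexp, map_sub, map_natCast, toPoonen_single_natCast, mul_sub, mul_one, ← pow_succ',
      Nat.sub_add_cancel (Nat.pow_pos hp.out.pos)]

theorem exists_limit_of_distProd (b e : ℕ → GenPowerSeries A)
    (h : ∀ n, b (n + 1) = b n + distProd p A n * e n) :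
    ∃ (c : GenPowerSeries A) (f g : ℕ → GenPowerSeries A),
      ∀ n, c - b n = distProd p A n * f n + p * g n := by
  -- Modulo `p`, `D_i` may be replaced by a pure power of `t`, to which `exists_limit_of_dvd`
  -- applies.
  let b' : ℕ → GenPowerSeries A := fun n =>
    b 0 + ∑ i ∈ Finset.range n, single (geomExp p i) 1 * e i
  have hb' : ∀ n, (p : GenPowerSeries A) ∣ b' n - b n := by
    intro n
    induction n with
    | zero => simp [b']
    | succ n ih =>
      have : b' (n + 1) - b (n + 1) =
          (b' n - b n) - (distProd p A n - single (geomExp p n) 1) * e n := by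
        simp only [b', h n, Finset.sum_range_succ]
        ring
      rw [this]
      exact dvd_sub ih ((natCast_dvd_distProd_sub_single n).mul_right _)
  obtain ⟨c, hc⟩ := exists_limit_of_dvd (geomExp p) (geomExp_monotone p) b' fun n =>
    ⟨e n, by simp only [b', Finset.sum_range_succ]; ring⟩
  have hfg : ∀ n, ∃ f g, c - b n = distProd p A n * f + p * g := by
    intro n
    obtain ⟨f, hf⟩ := hc n
    obtain ⟨g, hg⟩ := hb' n
    obtain ⟨d, hd⟩ := natCast_dvd_distProd_sub_single (p := p) (A := A) n
    exact ⟨f, g - d * f, by linear_combination hf + hg - f * hd⟩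
  choose f g hfg using hfg
  exact ⟨c, f, g, hfg⟩

theorem frobSurj_poonenRing [hp : Fact p.Prime] [IsLocalRing A] (hA : ¬ IsUnit (p : A))
    (hA0 : ∀ a : A, (p : A) * a = 0 → a = 0) {σ : A →+* A} (hσ : Function.Bijective σ)
    (hσp : ∀ a, (p : A) ∣ σ a - a ^ p) : FrobSurj p (PoonenRing p A) :=
  frobenius_surjective_of_lift (natCast_dvd_frobLift_sub_pow hA hσp) (frobLift_surjective hσ)
    toPoonen_surjective (eq_zero_of_natCast_mul_eq_zero hA0) (distProd p A)
    (fun _ _ => toPoonen_iterate_frobLift_distProd_eq_zero σ)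
    (exists_isUnit_toPoonen_iterate_frobLift_distProd hA σ) exists_limit_of_distProd

end Poonen

/-! ### Rational powers of `p`, the ideals `I_n` and their balls -/

section Balls

open HahnSeries

variable {p : ℕ} {A : Type*} [CommRing A]

/-- The image of `t^a` in `A⟦t^ℚ⟧ / (t - p)`, a rational power of `p`. -/
noncomputable def primePow (p : ℕ) (A : Type*) [CommRing A] (a : ℚ≥0) : PoonenRing p A :=
  toPoonen p A (single a 1)

theorem primePow_add (a b : ℚ≥0) :
    primePow p A (a + b) = primePow p A a * primePow p A b := by
  rw [primePow, primePow, primePow, ← map_mul, single_mul_single, one_mul]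

theorem primePow_zero : primePow p A 0 = 1 :=
  map_one (toPoonen p A)

theorem primePow_one : primePow p A 1 = p :=
  toPoonen_single_one

theorem primePow_natCast (n : ℕ) : primePow p A n = p ^ n :=
  toPoonen_single_natCast n

theorem primePow_div_pow [hp : Fact p.Prime] (a : ℚ≥0) :
    primePow p A (a / p) ^ p = primePow p A a := by
  rw [primePow, ← map_pow, single_pow, one_pow, nsmul_eq_mul, natCast_mul_div_self, primePow]

theorem primePow_mul_cancel (hA0 : ∀ a : A, (p : A) * a = 0 → a = 0) (a : ℚ≥0)
    {r s : PoonenRing p A} (h : primePow p A a * r = primePow p A a * s) : r = s := by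
  obtain ⟨n, hn⟩ := exists_nat_ge a
  refine natCast_pow_mul_cancel (eq_zero_of_natCast_mul_eq_zero hA0) n ?_
  rw [← primePow_natCast, ← tsub_add_cancel_of_le hn, primePow_add, mul_assoc, h, mul_assoc]

/-- For a lift `b` of `x`, `φ(b)` lies in `(t^a, p)`, as `b^p ≡ φ(b)` modulo `p` and `t^a` divides
`t` for `a ≤ 1`. Undoing `φ` puts `b` in `(t^{a/p}, p)`, and `p^{a/p}` divides `p` in the quotient.
-/
theorem primePow_div_dvd [hp : Fact p.Prime] (hA : ¬ IsUnit (p : A)) {σ : A →+* A}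
    (hσ : Function.Bijective σ) (hσp : ∀ a, (p : A) ∣ σ a - a ^ p) {a : ℚ≥0} (ha : a ≤ 1)
    {x : PoonenRing p A} (h : primePow p A a ∣ x ^ p) : primePow p A (a / p) ∣ x := by
  obtain ⟨b, rfl⟩ := toPoonen_surjective x
  obtain ⟨r, hr⟩ := h
  obtain ⟨z, rfl⟩ := toPoonen_surjective r
  rw [primePow, ← map_mul, ← map_pow, ← sub_eq_zero, ← map_sub, toPoonen_eq_zero_iff] at hr
  obtain ⟨w, hw⟩ := hr
  have h1 : single (1 : ℚ≥0) (1 : A) = single a 1 * single (1 - a) 1 := by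
    rw [single_mul_single, one_mul, add_tsub_cancel_of_le ha]
  obtain ⟨d, hd⟩ := natCast_dvd_frobLift_sub_pow hA hσp b
  obtain ⟨y, hy⟩ := frobLift_surjective hσ (p := p) (z + single (1 - a) 1 * w)
  obtain ⟨v, hv⟩ := frobLift_surjective hσ (p := p) (d - w)
  have hinj : Function.Injective (frobLift p σ) := by
    rw [injective_iff_map_eq_zero]
    intro c hc
    ext i
    have := coeff_frobLift (p := p) σ c i
    rw [hc, coeff_zero] at this
    exact hσ.1 (this.symm.trans (map_zero σ).symm)
  have hb : b = single (a / p) 1 * y + (p : GenPowerSeries A) * v := by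
    refine hinj ?_
    rw [map_add, map_mul, map_mul, frobLift_single, natCast_mul_div_self, map_natCast, hy, hv]
    linear_combination hd + hw + w * h1
  have h2 : primePow p A 1 = primePow p A (a / p) * primePow p A (1 - a / p) := by
    rw [← primePow_add, add_tsub_cancel_of_le]
    exact (div_le_self zero_le (Nat.one_le_cast.2 hp.out.one_lt.le)).trans ha
  rw [hb, map_add, map_mul, map_mul, map_natCast, ← primePow_one, h2, mul_assoc]
  exact dvd_add (dvd_mul_right _ _) (dvd_mul_right _ _)

theorem primePow_geomExp_succ_pow [hp : Fact p.Prime] (n : ℕ) :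
    primePow p A (geomExp p (n + 1) / p) ^ p = p * primePow p A (geomExp p n / p) := by
  rw [primePow_div_pow, geomExp_succ, primePow_add, primePow_one]

theorem frobIdeal_succ_le [Fact p.Prime] (R : Type*) [CommRing R] (n : ℕ) :
    frobIdeal p R (n + 1) ≤ frobIdeal p R n :=
  frobSet_succ_subset p R n

theorem primePow_geomExp_mem [hp : Fact p.Prime] (n : ℕ) :
    primePow p A (geomExp p n / p) ∈ frobIdeal p (PoonenRing p A) n := by
  induction n with
  | zero => trivial
  | succ n ih => exact ⟨_, ih, primePow_geomExp_succ_pow n⟩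

/-- The ideal `I_n` is generated by `p` to the power `1/p + ⋯ + 1/p^n`. -/
theorem mem_frobIdeal_iff [hp : Fact p.Prime] (hA : ¬ IsUnit (p : A))
    (hA0 : ∀ a : A, (p : A) * a = 0 → a = 0) {σ : A →+* A}
    (hσ : Function.Bijective σ) (hσp : ∀ a, (p : A) ∣ σ a - a ^ p) (n : ℕ)
    (x : PoonenRing p A) :
    x ∈ frobIdeal p (PoonenRing p A) n ↔ primePow p A (geomExp p n / p) ∣ x := by
  refine ⟨fun h => ?_, fun h => Ideal.mem_of_dvd _ h (primePow_geomExp_mem n)⟩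
  induction n generalizing x with
  | zero => simp [geomExp, primePow_zero]
  | succ n ih =>
    -- `primePow_div_dvd` needs an exponent at most 1, so the known factor of `x` is removed first;
    -- what remains is that `p^{1/p^n}` divides `y^p`.
    obtain ⟨y, rfl⟩ := ih x (frobSet_succ_subset p _ n h)
    obtain ⟨s, hs, hxs⟩ := h
    obtain ⟨z, rfl⟩ := ih s hs
    have hsum : geomExp p (n + 1) = geomExp p n + (p ^ n : ℚ≥0)⁻¹ := by
      rw [geomExp, Finset.sum_range_succ, geomExp]
    have h1 : y ^ p = primePow p A ((p ^ n : ℚ≥0)⁻¹) * z := by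
      refine primePow_mul_cancel hA0 (geomExp p n) ?_
      rw [mul_pow, primePow_div_pow] at hxs
      rw [hxs, ← mul_assoc, ← mul_assoc, ← primePow_add, ← hsum, geomExp_succ, primePow_add,
        primePow_one]
    have hle : ((p : ℚ≥0) ^ n)⁻¹ ≤ 1 :=
      inv_le_one_of_one_le₀ (one_le_pow₀ (Nat.one_le_cast.2 hp.out.one_lt.le))
    rw [hsum, add_div, primePow_add]
    exact mul_dvd_mul_left _ (primePow_div_dvd hA hσ hσp hle ⟨z, h1⟩)

theorem ballsIntersect_poonenRing [hp : Fact p.Prime] (hA : ¬ IsUnit (p : A))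
    (hA0 : ∀ a : A, (p : A) * a = 0 → a = 0) {σ : A →+* A}
    (hσ : Function.Bijective σ) (hσp : ∀ a, (p : A) ∣ σ a - a ^ p) :
    BallsIntersect p (PoonenRing p A) := by
  intro r hr
  have hmem := mem_frobIdeal_iff hA hA0 hσ hσp
  have hdiff : ∀ n, ∃ e : GenPowerSeries A,
      r (n + 1) - r n = primePow p A (geomExp p n / p) * toPoonen p A e := by
    intro n
    have h : r (n + 1) ∈ ball (r (n + 1)) (frobIdeal p (PoonenRing p A) (n + 1)) := by
      rw [ball, Set.mem_ofPred_eq, sub_self]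
      exact zero_mem _
    obtain ⟨e, he⟩ := (hmem n _).1 (hr n h)
    obtain ⟨e, rfl⟩ := toPoonen_surjective e
    exact ⟨e, he⟩
  choose e he using hdiff
  obtain ⟨b₀, hb₀⟩ := toPoonen_surjective (r 0)
  -- Lifts of the centres whose differences are divisible by powers of `t` before passing to the
  -- quotient.
  let b : ℕ → GenPowerSeries A := fun n =>
    b₀ + ∑ i ∈ Finset.range n, single (geomExp p i / p) 1 * e i
  have hb : ∀ n, toPoonen p A (b n) = r n := by
    intro n
    induction n with
    | zero => simpa [b] using hb₀
    | succ n ih =>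
      have : b (n + 1) = b n + single (geomExp p n / p) 1 * e n := by
        simp only [b, Finset.sum_range_succ]
        ring
      rw [this, map_add, ih, map_mul, ← primePow, ← he]
      ring
  obtain ⟨c, hc⟩ := exists_limit_of_dvd (fun n => geomExp p n / p)
    (fun m n h => div_le_div_of_nonneg_right (geomExp_monotone p h) zero_le) b
    fun n => ⟨e n, by simp only [b, Finset.sum_range_succ]; ring⟩
  refine ⟨toPoonen p A c, Set.mem_iInter.2 fun n => ?_⟩
  rw [ball, Set.mem_ofPred_eq, hmem, ← hb, ← map_sub]
  exact map_dvd (toPoonen p A) (hc n)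

end Balls

/-! ### `p`-th roots modulo `p I_n` and `p I_∞` -/

section Roots

open HahnSeries

variable {p : ℕ} [hp : Fact p.Prime] {A : Type*} [CommRing A]

theorem exists_natCast_dvd_pow_sub (hA : ¬ IsUnit (p : A)) {σ : A →+* A}
    (hσ : Function.Bijective σ) (hσp : ∀ a, (p : A) ∣ σ a - a ^ p) (r : PoonenRing p A) :
    ∃ s, (p : PoonenRing p A) ∣ s ^ p - r := by
  obtain ⟨b, rfl⟩ := toPoonen_surjective r
  obtain ⟨c, rfl⟩ := frobLift_surjective hσ (p := p) b
  refine ⟨toPoonen p A c, ?_⟩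
  have := map_dvd (toPoonen p A) (natCast_dvd_frobLift_sub_pow hA hσp c)
  rwa [map_natCast, map_sub, map_pow, dvd_sub_comm] at this

/-- A `p`-th root modulo `p I_n` deforms to one modulo `p I_{n+1}`. -/
theorem exists_pow_sub_step (hA : ¬ IsUnit (p : A)) {σ : A →+* A}
    (hσ : Function.Bijective σ) (hσp : ∀ a, (p : A) ∣ σ a - a ^ p) (n : ℕ)
    (r x : PoonenRing p A)
    (h : (p : PoonenRing p A) * primePow p A (geomExp p n / p) ∣ x ^ p - r) :
    ∃ c, (p : PoonenRing p A) * primePow p A (geomExp p (n + 1) / p) ∣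
      (x + primePow p A (geomExp p (n + 1) / p) * c) ^ p - r := by
  obtain ⟨e, he⟩ := h
  -- The `p`-th power of the correction is `p · p^{1/p + ⋯ + 1/p^n} c^p`, so `c^p ≡ -e` modulo `p`
  -- cancels the error.
  obtain ⟨c, d, hd⟩ := exists_natCast_dvd_pow_sub hA hσ hσp (-e)
  obtain ⟨q, hq⟩ := exists_add_pow_prime_eq hp.out x (primePow p A (geomExp p (n + 1) / p) * c)
  have hle : geomExp p (n + 1) / p ≤ 1 + geomExp p n / p := by
    rw [← geomExp_succ]
    exact div_le_self zero_le (Nat.one_le_cast.2 hp.out.one_lt.le)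
  have h2 : (p : PoonenRing p A) * primePow p A (geomExp p n / p) =
      primePow p A (geomExp p (n + 1) / p) *
        primePow p A (1 + geomExp p n / p - geomExp p (n + 1) / p) := by
    rw [← primePow_add, add_tsub_cancel_of_le hle, primePow_add, primePow_one]
  refine ⟨c, primePow p A (1 + geomExp p n / p - geomExp p (n + 1) / p) * d + x * c * q, ?_⟩
  rw [hq, mul_pow, primePow_geomExp_succ_pow]
  linear_combination he + p * primePow p A (geomExp p n / p) * hd + p * d * h2

theorem exists_pow_sub_eq_mul_mem_frobIdealInf (hA : ¬ IsUnit (p : A))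
    (hA0 : ∀ a : A, (p : A) * a = 0 → a = 0) {σ : A →+* A}
    (hσ : Function.Bijective σ) (hσp : ∀ a, (p : A) ∣ σ a - a ^ p) (r : PoonenRing p A) :
    ∃ x, ∃ z ∈ frobIdealInf p (PoonenRing p A), x ^ p - r = p * z := by
  choose c hc using exists_pow_sub_step hA hσ hσp
  obtain ⟨x₀, hx₀⟩ := exists_natCast_dvd_pow_sub hA hσ hσp r
  let x : ∀ n, {x : PoonenRing p A //
      (p : PoonenRing p A) * primePow p A (geomExp p n / p) ∣ x ^ p - r} := fun n =>
    Nat.rec ⟨x₀, by simpa [geomExp, primePow_zero] using hx₀⟩ (fun n y => ⟨_, hc n r y.1 y.2⟩) n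
  have hx : ∀ n, (x (n + 1)).1 - (x n).1 ∈ frobIdeal p (PoonenRing p A) (n + 1) := by
    intro n
    have : (x (n + 1)).1 - (x n).1 =
        primePow p A (geomExp p (n + 1) / p) * c n r (x n).1 (x n).2 := add_sub_cancel_left _ _
    rw [this]
    exact Ideal.mul_mem_right _ _ (primePow_geomExp_mem _)
  obtain ⟨y, hy⟩ := ballsIntersect_poonenRing hA hA0 hσ hσp (fun n => (x n).1) fun n z hz => by
    have := add_mem (frobIdeal_succ_le _ n hz) (frobIdeal_succ_le _ n (hx n))
    rwa [sub_add_sub_cancel] at this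
  have hn : ∀ n, ∃ z ∈ frobIdeal p (PoonenRing p A) n, y ^ p - r = p * z := by
    intro n
    -- Stage `n + 1` is used because `p`-th powers of elements of `I_{n+1}` lie in `p I_n`.
    have hy' : y - (x (n + 1)).1 ∈ frobIdeal p _ (n + 1) := Set.mem_iInter.1 hy (n + 1)
    obtain ⟨s, hs, hys⟩ := id hy'
    obtain ⟨q, hq⟩ := exists_add_pow_prime_eq hp.out (x (n + 1)).1 (y - (x (n + 1)).1)
    obtain ⟨d, hd⟩ := (x (n + 1)).2
    rw [add_sub_cancel, hys] at hq
    refine ⟨primePow p A (geomExp p (n + 1) / p) * d + s +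
      (x (n + 1)).1 * q * (y - (x (n + 1)).1), ?_, by linear_combination hq + hd⟩
    refine add_mem (add_mem ?_ hs) ?_
    · exact Ideal.mul_mem_right _ _ (frobIdeal_succ_le _ n (primePow_geomExp_mem _))
    · exact Ideal.mul_mem_left _ _ (frobIdeal_succ_le _ n hy')
  obtain ⟨z, -, hz⟩ := hn 0
  refine ⟨y, z, ?_, hz⟩
  rw [frobIdealInf, Ideal.mem_iInf]
  intro n
  obtain ⟨z', hz', h⟩ := hn n
  -- Cancelling `p` shows that one `z` serves all `n`, so it lies in `I_∞`.
  have : z = z' := sub_eq_zero.1 <| eq_zero_of_natCast_mul_eq_zero hA0 _ <| by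
    rw [mul_sub, ← hz, ← h, sub_self]
  rwa [this]

theorem otherConditions_poonenRing [IsLocalRing A] (hA : ¬ IsUnit (p : A))
    (hA0 : ∀ a : A, (p : A) * a = 0 → a = 0) {σ : A →+* A}
    (hσ : Function.Bijective σ) (hσp : ∀ a, (p : A) ∣ σ a - a ^ p) :
    OtherConditions p (PoonenRing p A) := by
  have hF := frobSurj_poonenRing hA hA0 hσ hσp
  have hT := truncFrobenius_surjective hF
  have hroot := exists_natCast_dvd_pow_sub hA hσ hσp
  have hquot : ∀ I : Ideal (PoonenRing p A), (∀ r, ∃ s, s ^ p - r ∈ I) →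
      Function.Surjective (fun x : PoonenRing p A ⧸ I => x ^ p) := by
    intro I h r
    obtain ⟨r, rfl⟩ := Ideal.Quotient.mk_surjective r
    obtain ⟨s, hs⟩ := h r
    refine ⟨Ideal.Quotient.mk I s, ?_⟩
    change Ideal.Quotient.mk I s ^ p = Ideal.Quotient.mk I r
    rw [← sub_eq_zero, ← map_pow, ← map_sub, Ideal.Quotient.eq_zero_iff_mem]
    exact hs
  have hinf : ∀ I : Ideal (PoonenRing p A), frobIdealInf p (PoonenRing p A) ≤ I →
      ∀ r, ∃ s, s ^ p - r ∈ Ideal.span {(p : PoonenRing p A)} * I := by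
    intro I hI r
    obtain ⟨x, z, hz, h⟩ := exists_pow_sub_eq_mul_mem_frobIdealInf hA hA0 hσ hσp r
    exact ⟨x, Ideal.mem_span_singleton_mul.2 ⟨z, hI hz, h.symm⟩⟩
  have hmul : PthRootsPMul p (PoonenRing p A) := by
    intro r
    obtain ⟨s, d, hd⟩ := hroot r
    -- Multiply a `p`-th root of `r` modulo `p` by `p^{1/p}`.
    refine ⟨primePow p A (1 / p) * s, d, ?_⟩
    rw [mul_pow, primePow_div_pow, primePow_one]
    linear_combination p * hd
  obtain ⟨ρ, hρ⟩ := hmul (-1)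
  have hρ' : (p : PoonenRing p A) * p ∣ ρ ^ p - -(p : PoonenRing p A) := by
    rwa [← pow_two, ← mul_neg_one (p : PoonenRing p A)]
  exact
    { frobSurjFinite := fun n _ => hT n
      frobSurjFiniteTwo := hT 2
      teichDense := teichDense_of_frobSurj (eq_zero_of_natCast_mul_eq_zero hA0) hF
      teichInImage := fun _ => hF _
      teichInImageFinite := fun n _ _ => hT n _
      teichInImageFiniteTwo := fun _ => hT 2 _
      vOneInImage := hF _
      vOneInImageFinite := fun n _ => hT n _
      vPowOneInImageFinite := fun n _ => hT n _
      vOneInImageFiniteTwo := hT 2 _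
      frobIterSurj := fun n _ => truncFrobeniusIter_surjective hF n
      frobIterSurjOne := hT 1
      ballsIntersect := ballsIntersect_poonenRing hA hA0 hσ hσp
      pthRootsInf := hquot _ (hinf _ le_rfl)
      pthRootsFinite := fun n _ => hquot _ (hinf _ (iInf_le _ n))
      pthRootsFiniteOne := hquot _ (hinf _ (iInf_le _ 1))
      pthRootsPMul := hmul
      -- The choice `s = p` works: `p^p = p · p^{p-1}`, and `I_0` is all of `R`.
      pthRootNegP := ⟨ρ, p, hρ', p ^ (p - 1), trivial, by
        rw [← pow_succ', Nat.sub_add_cancel hp.out.one_lt.le]⟩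
      pthRootNegPWeak := ⟨ρ, p, hρ', 1, one_pos, by rw [pow_one]⟩
      pthRootsModP := hquot _ fun r => by
        simpa only [Ideal.mem_span_singleton] using hroot r }

end Roots

/-! ### Frobenius lifts on the two coefficient rings -/

theorem padicInt_natCast_dvd_sub_pow (p : ℕ) [hp : Fact p.Prime] (a : ℤ_[p]) :
    (p : ℤ_[p]) ∣ RingHom.id ℤ_[p] a - a ^ p := by
  rw [← Ideal.mem_span_singleton, ← PadicInt.maximalIdeal_eq_span_p, ← PadicInt.ker_toZMod,
    RingHom.mem_ker, map_sub, map_pow, ZMod.pow_card, RingHom.id_apply, sub_self]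

/-- Over a perfect field, divisibility by `p` is read off the zeroth component, where `F` is the
`p`-th power. -/
theorem wittVector_natCast_dvd_frobenius_sub_pow (p : ℕ) [hp : Fact p.Prime] {k : Type*} [Field k]
    [CharP k p] [PerfectRing k p] (a : WittVector p k) :
    (p : WittVector p k) ∣ WittVector.frobenius a - a ^ p := by
  rw [← Ideal.mem_span_singleton, WittVector.mem_span_p_iff_coeff_zero_eq_zero]
  have h := map_sub (WittVector.constantCoeff (p := p) (R := k)) (WittVector.frobenius a) (a ^ p)
  rw [map_pow] at h
  refine h.trans (sub_eq_zero.2 ?_)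
  exact WittVector.coeff_frobenius_charP p a 0

end WittFrobenius

theorem mainTheorem7 (p : ℕ) [Fact p.Prime] :
    (WittFrobenius.FrobSurj p (WittFrobenius.PoonenRing p ℤ_[p]) ∧
      WittFrobenius.OtherConditions p (WittFrobenius.PoonenRing p ℤ_[p]) ∧
      ¬ WittFrobenius.PInvertible p (WittFrobenius.PoonenRing p ℤ_[p])) ∧
    (WittFrobenius.FrobSurj p
        (WittFrobenius.PoonenRing p (WittVector p (AlgebraicClosure (ZMod p)))) ∧
      WittFrobenius.OtherConditions p
        (WittFrobenius.PoonenRing p (WittVector p (AlgebraicClosure (ZMod p)))) ∧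
      ¬ WittFrobenius.PInvertible p
        (WittFrobenius.PoonenRing p (WittVector p (AlgebraicClosure (ZMod p))))) := by
  constructor
  · have hA : ¬ IsUnit (p : ℤ_[p]) := PadicInt.prime_p.not_isUnit
    have hA0 : ∀ a : ℤ_[p], (p : ℤ_[p]) * a = 0 → a = 0 := fun a h =>
      (mul_eq_zero.1 h).resolve_left PadicInt.prime_p.ne_zero
    have hσ : Function.Bijective (RingHom.id ℤ_[p]) := Function.bijective_id
    have hσp := WittFrobenius.padicInt_natCast_dvd_sub_pow p
    exact ⟨WittFrobenius.frobSurj_poonenRing hA hA0 hσ hσp,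
      WittFrobenius.otherConditions_poonenRing hA hA0 hσ hσp, WittFrobenius.not_pInvertible hA⟩
  · have hirr : Irreducible (p : WittVector p (AlgebraicClosure (ZMod p))) :=
      WittVector.irreducible p
    have hA0 : ∀ a : WittVector p (AlgebraicClosure (ZMod p)),
        (p : WittVector p (AlgebraicClosure (ZMod p))) * a = 0 → a = 0 := fun a h =>
      (mul_eq_zero.1 h).resolve_left hirr.ne_zero
    have hσ := WittVector.frobenius_bijective p (AlgebraicClosure (ZMod p))
    have hσp := WittFrobenius.wittVector_natCast_dvd_frobenius_sub_pow p
      (k := AlgebraicClosure (ZMod p))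
    exact ⟨WittFrobenius.frobSurj_poonenRing hirr.not_isUnit hA0 hσ hσp,
      WittFrobenius.otherConditions_poonenRing hirr.not_isUnit hA0 hσ hσp,
      WittFrobenius.not_pInvertible hirr.not_isUnit⟩
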